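/- All Hilbert spaces are complex, $\hat\otimes_2$ is the Hilbert tensor product, and $f^{\dagger}$ is the Hilbert adjoint of a bounded linear map $f$. A commutative Hilbertian Frobenius semigroup $(H,\mu)$ consists of a Hilbert space $H$ and a bounded linear map $\mu\colon H\hat\otimes_2 H\to H$, written $xy:=\mu(x\otimes y)$, which is commutative and associative and satisfies the Frobenius condition $$(\mu\hat\otimes_2\mathrm{id})\circ\alpha^{-1}\circ(\mathrm{id}\hat\otimes_2\mu^{\dagger})=\mu^{\dagger}\circ\mu=(\mathrm{id}\hat\otimes_2\mu)\circ\alpha\circ(\mu^{\dagger}\hat\otimes_2\mathrm{id}),$$ where $\alpha\colon (H\hat\otimes_2H)\hat\otimes_2H\to H\hat\otimes_2(H\hat\otimes_2H)$ is the associativity isomorphism. Let - $J=J(H,\mu)$ be the Jacobson radical of the algebra $(H,\mu)$, that is, the intersection of all its maximal modular ideals ($J=H$ if there are none); - $A(H,\mu)=\{x\in H : xy=0 \text{ for all } y\in H\}$ be its annihilator; - $G(H,\mu)=\{x\in H\setminus\{0\} : \mu^{\dagger}(x)=x\otimes x\}$ be its set of group-like elements. A closed subalgebra (respectively a closed subcoalgebra)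 of $(H,\mu)$ is a closed linear subspace $V\subseteq H$ with $\mu(V\hat\otimes_2V)\subseteq V$ (respectively $\mu^{\dagger}(V)\subseteq V\hat\otimes_2V$), where $V\hat\otimes_2 V$ is regarded as a closed subspace of $H\hat\otimes_2H$. **Theorem (Structure Theorem for Hilbertian Frobenius Semigroups).** Let $(H,\mu)$ be a commutative Hilbertian Frobenius semigroup. Then $J$ is closed and $H=J\oplus_2J^{\perp}$ (orthogonal direct sum of Hilbert spaces); $J^{\perp}$ is the closure of the linear span of $G(H,\mu)$; $J^{\perp}$ is both a closed subalgebra and a closed subcoalgebra of $(H,\mu)$; $J=A(H,\mu)$, and $J$ is also both a closed subalgebra and a closed subcoalgebra of $(H,\mu)$. In particular, $J$ and $J^{\perp}$ are ideals. -/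

import Mathlib

open scoped TensorProduct

noncomputable section

namespace HilbFrob

universe u v w x

section TensorProduct

variable {H : Type u} {K : Type v} {L : Type w} {M : Type x}
  [NormedAddCommGroup H] [InnerProductSpace ℂ H]
  [NormedAddCommGroup K] [InnerProductSpace ℂ K]
  [NormedAddCommGroup L] [InnerProductSpace ℂ L]
  [NormedAddCommGroup M] [InnerProductSpace ℂ M]

/-- The Hilbert tensor product: the completion of the algebraic tensor product for the inner
product `⟪a ⊗ b, c ⊗ d⟫ = ⟪a, c⟫ ⟪b, d⟫`. -/
abbrev HTensor (H : Type u) (K : Type v)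
    [NormedAddCommGroup H] [InnerProductSpace ℂ H]
    [NormedAddCommGroup K] [InnerProductSpace ℂ K] : Type (max u v) :=
  UniformSpace.Completion (H ⊗[ℂ] K)

/-- The elementary tensor `a ⊗ b` in the Hilbert tensor product. -/
def htmul (a : H) (b : K) : HTensor H K := ((a ⊗ₜ[ℂ] b : H ⊗[ℂ] K) : HTensor H K)

/-- The tensor product `f ⊗ g` of two bounded linear maps. -/
def hmap (f : H →L[ℂ] L) (g : K →L[ℂ] M) : HTensor H K →L[ℂ] HTensor L M :=
  (TensorProduct.mapL f g).completion

@[simp]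
theorem hmap_htmul (f : H →L[ℂ] L) (g : K →L[ℂ] M) (a : H) (b : K) :
    hmap f g (htmul a b) = htmul (f a) (g b) := by
  simp [hmap, htmul]

/-- The symmetry `a ⊗ b ↦ b ⊗ a` of the Hilbert tensor product. -/
def hcomm (H : Type u) (K : Type v)
    [NormedAddCommGroup H] [InnerProductSpace ℂ H]
    [NormedAddCommGroup K] [InnerProductSpace ℂ K] : HTensor H K →L[ℂ] HTensor K H :=
  ((TensorProduct.commIsometry ℂ H K).toLinearIsometry.toContinuousLinearMap).completion

@[simp]
theorem hcomm_htmul (a : H) (b : K) : hcomm H K (htmul a b) = htmul b a := by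
  simp [hcomm, htmul]

/-- The dense isometric embedding of `(H ⊗ K) ⊗ L` in its completion. -/
def embLeft (H : Type u) (K : Type v) (L : Type w)
    [NormedAddCommGroup H] [InnerProductSpace ℂ H]
    [NormedAddCommGroup K] [InnerProductSpace ℂ K]
    [NormedAddCommGroup L] [InnerProductSpace ℂ L] :
    (H ⊗[ℂ] K) ⊗[ℂ] L →ₗᵢ[ℂ] HTensor (HTensor H K) L :=
  UniformSpace.Completion.toComplₗᵢ.comp
    ((UniformSpace.Completion.toComplₗᵢ (𝕜 := ℂ) (E := H ⊗[ℂ] K)).rTensor L)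

/-- The dense isometric embedding of `H ⊗ (K ⊗ L)` in its completion. -/
def embRight (H : Type u) (K : Type v) (L : Type w)
    [NormedAddCommGroup H] [InnerProductSpace ℂ H]
    [NormedAddCommGroup K] [InnerProductSpace ℂ K]
    [NormedAddCommGroup L] [InnerProductSpace ℂ L] :
    H ⊗[ℂ] (K ⊗[ℂ] L) →ₗᵢ[ℂ] HTensor H (HTensor K L) :=
  UniformSpace.Completion.toComplₗᵢ.comp
    ((UniformSpace.Completion.toComplₗᵢ (𝕜 := ℂ) (E := K ⊗[ℂ] L)).lTensor H)

theorem embLeft_tmul (a : H) (b : K) (c : L) :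
    embLeft H K L ((a ⊗ₜ[ℂ] b) ⊗ₜ[ℂ] c) = htmul (htmul a b) c := by
  simp [embLeft, htmul]

theorem embRight_tmul (a : H) (b : K) (c : L) :
    embRight H K L (a ⊗ₜ[ℂ] (b ⊗ₜ[ℂ] c)) = htmul a (htmul b c) := by
  simp [embRight, htmul]

theorem denseRange_rTensor {f : H →ₗᵢ[ℂ] L} (hf : DenseRange f) :
    DenseRange (f.rTensor K) := by
  have key : ∀ (z : L ⊗[ℂ] K), z ∈ (LinearMap.range (f.rTensor K).toLinearMap).topologicalClosure := by
    intro z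
    induction z using TensorProduct.induction_on with
    | zero => exact zero_mem _
    | add a b ha hb => exact add_mem ha hb
    | tmul a b =>
      have hc : Continuous fun y : L => y ⊗ₜ[ℂ] b :=
        TensorProduct.continuous_tmul.comp (Continuous.prodMk continuous_id continuous_const)
      have hcl : IsClosed {y : L | y ⊗ₜ[ℂ] b ∈
          (LinearMap.range (f.rTensor K).toLinearMap).topologicalClosure} :=
        (Submodule.isClosed_topologicalClosure _).preimage hc
      refine hf.induction_on (p := fun y : L => y ⊗ₜ[ℂ] b ∈
          (LinearMap.range (f.rTensor K).toLinearMap).topologicalClosure) a hcl fun y => ?_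
      exact Submodule.le_topologicalClosure _ ⟨y ⊗ₜ[ℂ] b, by simp⟩
  intro z
  have h := key z
  rw [← SetLike.mem_coe, Submodule.topologicalClosure_coe] at h
  exact h

theorem denseRange_lTensor {f : H →ₗᵢ[ℂ] L} (hf : DenseRange f) :
    DenseRange (f.lTensor K) := by
  have key : ∀ (z : K ⊗[ℂ] L), z ∈ (LinearMap.range (f.lTensor K).toLinearMap).topologicalClosure := by
    intro z
    induction z using TensorProduct.induction_on with
    | zero => exact zero_mem _
    | add a b ha hb => exact add_mem ha hb
    | tmul b a =>
      have hc : Continuous fun y : L => b ⊗ₜ[ℂ] y :=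
        TensorProduct.continuous_tmul.comp (Continuous.prodMk continuous_const continuous_id)
      have hcl : IsClosed {y : L | b ⊗ₜ[ℂ] y ∈
          (LinearMap.range (f.lTensor K).toLinearMap).topologicalClosure} :=
        (Submodule.isClosed_topologicalClosure _).preimage hc
      refine hf.induction_on (p := fun y : L => b ⊗ₜ[ℂ] y ∈
          (LinearMap.range (f.lTensor K).toLinearMap).topologicalClosure) a hcl fun y => ?_
      exact Submodule.le_topologicalClosure _ ⟨b ⊗ₜ[ℂ] y, by simp⟩
  intro z
  have h := key z
  rw [← SetLike.mem_coe, Submodule.topologicalClosure_coe] at h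
  exact h

theorem denseRange_embLeft : DenseRange (embLeft H K L) :=
  UniformSpace.Completion.denseRange_coe.comp
    (denseRange_rTensor UniformSpace.Completion.denseRange_coe)
    (UniformSpace.Completion.continuous_coe _)

theorem denseRange_embRight : DenseRange (embRight H K L) :=
  UniformSpace.Completion.denseRange_coe.comp
    (denseRange_lTensor UniformSpace.Completion.denseRange_coe)
    (UniformSpace.Completion.continuous_coe _)

/-- The associativity constraint `(a ⊗ b) ⊗ c ↦ a ⊗ (b ⊗ c)` of the Hilbert tensor product, as a
unitary map. -/
def hassoc (H : Type u) (K : Type v) (L : Type w)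
    [NormedAddCommGroup H] [InnerProductSpace ℂ H]
    [NormedAddCommGroup K] [InnerProductSpace ℂ K]
    [NormedAddCommGroup L] [InnerProductSpace ℂ L] :
    HTensor (HTensor H K) L ≃ₗᵢ[ℂ] HTensor H (HTensor K L) :=
  (TensorProduct.assocIsometry ℂ H K L).toLinearEquiv.extendOfIsometry
    (embLeft H K L).toLinearMap (embRight H K L).toLinearMap
    denseRange_embLeft denseRange_embRight (fun z => by
      change ‖embRight H K L (TensorProduct.assocIsometry ℂ H K L z)‖ = ‖embLeft H K L z‖
      rw [LinearIsometry.norm_map, LinearIsometry.norm_map, LinearIsometryEquiv.norm_map])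

theorem hassoc_htmul (a : H) (b : K) (c : L) :
    hassoc H K L (htmul (htmul a b) c) = htmul a (htmul b c) := by
  rw [← embLeft_tmul, ← embRight_tmul]
  exact LinearEquiv.extendOfIsometry_eq (TensorProduct.assocIsometry ℂ H K L).toLinearEquiv
    (embLeft H K L).toLinearMap (embRight H K L).toLinearMap
    denseRange_embLeft denseRange_embRight _ ((a ⊗ₜ[ℂ] b) ⊗ₜ[ℂ] c)

/-- For a closed subspace `V` of `H`, the Hilbert tensor product `V ⊗ V` as a subspace of `H ⊗ H`,
namely the range of `i ⊗ i` for the inclusion `i : V → H`. -/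
def tensorSquare (V : Submodule ℂ H) : Submodule ℂ (HTensor H H) :=
  LinearMap.range (hmap V.subtypeL V.subtypeL).toLinearMap

end TensorProduct

section Algebra

variable {H : Type u} [NormedAddCommGroup H] [InnerProductSpace ℂ H]

/-- The product `a b = μ (a ⊗ b)`. -/
def prod (μ : HTensor H H →L[ℂ] H) (a b : H) : H := μ (htmul a b)

/-- Left ideals of the algebra underlying `(H, μ)`. -/
def IsLeftIdeal (μ : HTensor H H →L[ℂ] H) (I : Submodule ℂ H) : Prop :=
  ∀ a b : H, b ∈ I → prod μ a b ∈ I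

/-- Two-sided ideals of the algebra underlying `(H, μ)`. -/
def IsIdeal (μ : HTensor H H →L[ℂ] H) (I : Submodule ℂ H) : Prop :=
  ∀ a b : H, b ∈ I → prod μ a b ∈ I ∧ prod μ b a ∈ I

/-- A left ideal `I` is modular when there is `e` with `a - a e ∈ I` for all `a`. -/
def IsModularLeftIdeal (μ : HTensor H H →L[ℂ] H) (I : Submodule ℂ H) : Prop :=
  IsLeftIdeal μ I ∧ ∃ e : H, ∀ a : H, a - prod μ a e ∈ I

/-- Maximal modular left ideals: proper modular left ideals that are maximal among the proper left
ideals. -/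
def IsMaximalModularLeftIdeal (μ : HTensor H H →L[ℂ] H) (I : Submodule ℂ H) : Prop :=
  IsModularLeftIdeal μ I ∧ I ≠ ⊤ ∧
    ∀ I' : Submodule ℂ H, IsLeftIdeal μ I' → I ≤ I' → I' ≠ ⊤ → I' = I

/-- The Jacobson radical `J(H, μ)`: the intersection of all maximal modular left ideals (all of `H`
when there is none). -/
def jacobsonRadical (μ : HTensor H H →L[ℂ] H) : Submodule ℂ H :=
  sInf {I | IsMaximalModularLeftIdeal μ I}

/-- The annihilator `A(H, μ) = {a | ∀ b, a b = 0}`. -/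
def annihilator (μ : HTensor H H →L[ℂ] H) : Set H :=
  {a | ∀ b : H, prod μ a b = 0}

/-- (Closed) subalgebras: closed subspaces `V` with `μ (V ⊗ V) ⊆ V`. -/
structure IsClosedSubalgebra (μ : HTensor H H →L[ℂ] H) (V : Submodule ℂ H) : Prop where
  isClosed : IsClosed (V : Set H)
  mul_mem : ∀ t ∈ tensorSquare V, μ t ∈ V

variable [CompleteSpace H]

/-- (Closed) subcoalgebras: closed subspaces `V` with `μ† (V) ⊆ V ⊗ V`. -/
structure IsClosedSubcoalgebra (μ : HTensor H H →L[ℂ] H) (V : Submodule ℂ H) : Prop where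
  isClosed : IsClosed (V : Set H)
  comul_mem : ∀ a ∈ V, ContinuousLinearMap.adjoint μ a ∈ tensorSquare V

/-- The group-like elements: the non-zero `a` with `μ† a = a ⊗ a`. -/
def groupLike (μ : HTensor H H →L[ℂ] H) : Set H :=
  {a | a ≠ 0 ∧ ContinuousLinearMap.adjoint μ a = htmul a a}

/-- Commutative Hilbertian Frobenius semigroups: the bounded linear map `μ : H ⊗ H → H` is
commutative and associative, and it satisfies both halves of the Frobenius condition with its
Hilbert adjoint `μ†`. -/
structure IsCommHilbertianFrobeniusSemigroup (μ : HTensor H H →L[ℂ] H) : Prop where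
  comm : μ ∘L hcomm H H = μ
  assoc : μ ∘L hmap μ (ContinuousLinearMap.id ℂ H) =
    μ ∘L hmap (ContinuousLinearMap.id ℂ H) μ ∘L
      (hassoc H H H).toLinearIsometry.toContinuousLinearMap
  frobenius_left :
    hmap μ (ContinuousLinearMap.id ℂ H) ∘L
      (hassoc H H H).symm.toLinearIsometry.toContinuousLinearMap ∘L
      hmap (ContinuousLinearMap.id ℂ H) (ContinuousLinearMap.adjoint μ) =
    ContinuousLinearMap.adjoint μ ∘L μ
  frobenius_right :
    hmap (ContinuousLinearMap.id ℂ H) μ ∘L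
      (hassoc H H H).toLinearIsometry.toContinuousLinearMap ∘L
      hmap (ContinuousLinearMap.adjoint μ) (ContinuousLinearMap.id ℂ H) =
    ContinuousLinearMap.adjoint μ ∘L μ

end Algebra

end HilbFrob

end

open scoped TensorProduct InnerProductSpace

noncomputable section

namespace HilbFrob

/-! ### Elementary tensors in the Hilbert tensor product. -/

section TensorProduct

variable {H K E : Type*} [NormedAddCommGroup H] [InnerProductSpace ℂ H]
  [NormedAddCommGroup K] [InnerProductSpace ℂ K] [NormedAddCommGroup E] [NormedSpace ℂ E]

/-! Write `M_a` for multiplication by `a`. The Frobenius condition says that `M_a†` is a module map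
(`adjoint_mulOp_mul`), so by commutativity each `M_a` is normal. If `a ∈ J`, then `M_a` has no
nonzero spectrum; a normal operator has norm equal to its spectral radius, so `M_a = 0` and `J` is
the annihilator (`mem_jacobsonRadical_iff`).

Maximal modular ideals are closed, and by nonemptiness of the spectrum they have codimension one.
Hence each is `g^⊥` with `⟪g, ·⟫` multiplicative, that is, with `g` group-like (`exists_groupLike`),
which gives `J = G^⊥`.

Since a normal operator and its adjoint have the same kernel, `M_b a = 0` yields `M_b† a = 0`. So
`J` is orthogonal to all products: `μ†` vanishes on `J` and `μ` takes values in `J^⊥`. -/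

theorem inner_htmul (a c : H) (b d : K) :
    ⟪htmul a b, htmul c d⟫_ℂ = ⟪a, c⟫_ℂ * ⟪b, d⟫_ℂ := by
  simp [htmul]

theorem norm_htmul (a : H) (b : K) : ‖htmul a b‖ = ‖a‖ * ‖b‖ := by
  simp [htmul]

theorem htmul_add (a : H) (b c : K) : htmul a (b + c) = htmul a b + htmul a c := by
  rw [htmul, TensorProduct.tmul_add]
  exact map_add (UniformSpace.Completion.toComplₗᵢ (𝕜 := ℂ) (E := H ⊗[ℂ] K)) _ _

theorem htmul_smul (r : ℂ) (a : H) (b : K) : htmul a (r • b) = r • htmul a b := by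
  simp [htmul]

/-- The bounded linear map `b ↦ a ⊗ b`. -/
def htmulLeft (K : Type*) [NormedAddCommGroup K] [InnerProductSpace ℂ K] (a : H) :
    K →L[ℂ] HTensor H K :=
  LinearMap.mkContinuous
    { toFun := htmul a, map_add' := htmul_add a, map_smul' := fun r b => htmul_smul r a b }
    ‖a‖ fun b => (norm_htmul a b).le

@[simp]
theorem htmulLeft_apply (a : H) (b : K) : htmulLeft K a b = htmul a b := rfl

theorem norm_htmulLeft_le (a : H) : ‖htmulLeft K a‖ ≤ ‖a‖ :=
  LinearMap.mkContinuous_norm_le _ (norm_nonneg a) _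

/-- Bounded linear maps on the Hilbert tensor product are determined by elementary tensors. -/
theorem ext_htmul {f g : HTensor H K →L[ℂ] E}
    (h : ∀ a b, f (htmul a b) = g (htmul a b)) : f = g := by
  ext t
  induction t using UniformSpace.Completion.induction_on with
  | hp => exact isClosed_eq f.continuous g.continuous
  | ih t =>
    induction t using TensorProduct.induction_on with
    | zero => exact (map_zero f).trans (map_zero g).symm
    | tmul a b => exact h a b
    | add s t hs ht =>
      have : ((s + t : H ⊗[ℂ] K) : HTensor H K) = (s : HTensor H K) + t :=
        map_add (UniformSpace.Completion.toComplₗᵢ (𝕜 := ℂ) (E := H ⊗[ℂ] K)) _ _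
      rw [this, map_add, map_add, hs, ht]

theorem eq_of_inner_htmul {s t : HTensor H K}
    (h : ∀ a b, ⟪s, htmul a b⟫_ℂ = ⟪t, htmul a b⟫_ℂ) : s = t := by
  have : innerSL ℂ s = innerSL ℂ t := ext_htmul h
  exact ext_inner_right ℂ fun v => DFunLike.congr_fun this v

theorem htmul_mem_tensorSquare {V : Submodule ℂ H} {a b : H} (ha : a ∈ V) (hb : b ∈ V) :
    htmul a b ∈ tensorSquare V :=
  ⟨htmul (⟨a, ha⟩ : V) (⟨b, hb⟩ : V), by simp⟩

/-- The inclusion `i` has the continuous left inverse `r = P ⊗ P`, with `P` the projection onto `V`,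
so its range is the fixed-point set of `i ∘ r`. -/
theorem isClosed_tensorSquare (V : Submodule ℂ H) [V.HasOrthogonalProjection] :
    IsClosed (tensorSquare V : Set (HTensor H H)) := by
  set i := hmap V.subtypeL V.subtypeL
  set r := hmap V.orthogonalProjectionOnto V.orthogonalProjectionOnto
  have hri : r ∘L i = ContinuousLinearMap.id ℂ (HTensor V V) :=
    ext_htmul fun a b => by simp [r, i]
  have : (tensorSquare V : Set (HTensor H H)) = {t | i (r t) = t} := by
    ext t
    constructor
    · rintro ⟨s, rfl⟩
      exact congrArg i (DFunLike.congr_fun hri s)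
    · exact fun ht => ⟨r t, ht⟩
  rw [this]
  exact isClosed_eq (i.continuous.comp r.continuous) continuous_id

end TensorProduct

/-! ### Multiplication operators. -/

section Mul

variable {H : Type*} [NormedAddCommGroup H] [InnerProductSpace ℂ H] (μ : HTensor H H →L[ℂ] H)

/-- The multiplication operator `b ↦ a b`. -/
def mulOp (a : H) : H →L[ℂ] H := μ ∘L htmulLeft H a

@[simp]
theorem mulOp_apply (a b : H) : mulOp μ a b = prod μ a b := rfl

theorem norm_mulOp_le (a : H) : ‖mulOp μ a‖ ≤ ‖μ‖ * ‖a‖ :=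
  (ContinuousLinearMap.opNorm_comp_le _ _).trans (by gcongr; exact norm_htmulLeft_le a)

theorem mulOp_sub (a b : H) : mulOp μ (a - b) = mulOp μ a - mulOp μ b := by
  ext c
  have : htmul (a - b) c = htmul a c - htmul b c := by
    rw [htmul, TensorProduct.sub_tmul]
    exact map_sub (UniformSpace.Completion.toComplₗᵢ (𝕜 := ℂ) (E := H ⊗[ℂ] H)) _ _
  simp [prod, this]

theorem mulOp_smul (r : ℂ) (a : H) : mulOp μ (r • a) = r • mulOp μ a := by
  ext b
  simp [prod, htmul, ← TensorProduct.smul_tmul']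

end Mul

/-! ### Modular ideals. -/

section Ideal

variable {H : Type*} [NormedAddCommGroup H] [InnerProductSpace ℂ H] {μ : HTensor H H →L[ℂ] H}
  {I : Submodule ℂ H}

theorem IsLeftIdeal.eq_top_of_modular_unit_mem (hI : IsLeftIdeal μ I) {e : H}
    (he : ∀ a, a - prod μ a e ∈ I) (hmem : e ∈ I) : I = ⊤ :=
  Submodule.eq_top_iff'.2 fun a => (I.sub_mem_iff_left (hI a e hmem)).1 (he a)

theorem IsLeftIdeal.topologicalClosure (hI : IsLeftIdeal μ I) :
    IsLeftIdeal μ I.topologicalClosure := fun a _ hb =>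
  map_mem_closure (mulOp μ a).continuous hb fun c hc => hI a c hc

/-- A proper modular ideal is contained in a maximal modular ideal. -/
theorem IsModularLeftIdeal.exists_le_maximal (hI : IsModularLeftIdeal μ I) (hne : I ≠ ⊤) :
    ∃ M, IsMaximalModularLeftIdeal μ M ∧ I ≤ M := by
  obtain ⟨hleft, e, he⟩ := hI
  -- For left ideals above `I`, being proper means omitting `e`, a condition that survives unions of
  -- chains.
  obtain ⟨M, hIM, hM⟩ := zorn_le_nonempty₀ {M | IsLeftIdeal μ M ∧ e ∉ M} (by
    intro c hc hchain J hJ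
    have hdir : DirectedOn (· ≤ ·) c := hchain.directedOn
    refine ⟨sSup c, ⟨fun a b hb => ?_, fun hmem => ?_⟩, fun K hK => le_sSup hK⟩
    · obtain ⟨K, hK, hbK⟩ := (Submodule.mem_sSup_of_directed ⟨J, hJ⟩ hdir).1 hb
      exact le_sSup hK ((hc hK).1 a b hbK)
    · obtain ⟨K, hK, heK⟩ := (Submodule.mem_sSup_of_directed ⟨J, hJ⟩ hdir).1 hmem
      exact (hc hK).2 heK) I ⟨hleft, fun h => hne (hleft.eq_top_of_modular_unit_mem he h)⟩
  refine ⟨M, ⟨⟨hM.prop.1, e, fun a => hIM (he a)⟩, ?_, fun I' hI' hle hne' => ?_⟩, hIM⟩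
  · rintro rfl
    exact hM.prop.2 trivial
  · refine le_antisymm (hM.le_of_ge ⟨hI', fun h => hne' ?_⟩ hle) hle
    exact hI'.eq_top_of_modular_unit_mem (fun a => hle (hIM (he a))) h

end Ideal

/-! ### Consequences of the Frobenius condition. -/

namespace IsCommHilbertianFrobeniusSemigroup

variable {H : Type*} [NormedAddCommGroup H] [InnerProductSpace ℂ H] [CompleteSpace H]
  {μ : HTensor H H →L[ℂ] H} {I : Submodule ℂ H} {a g : H}

theorem mul_comm (hμ : IsCommHilbertianFrobeniusSemigroup μ) (a b : H) :
    prod μ a b = prod μ b a := by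
  simpa [prod] using (DFunLike.congr_fun hμ.comm (htmul b a))

theorem mul_assoc (hμ : IsCommHilbertianFrobeniusSemigroup μ) (a b c : H) :
    prod μ (prod μ a b) c = prod μ a (prod μ b c) := by
  have := DFunLike.congr_fun hμ.assoc (htmul (htmul a b) c)
  simpa [prod, hassoc_htmul] using this

theorem mul_left_comm (hμ : IsCommHilbertianFrobeniusSemigroup μ) (a b c : H) :
    prod μ a (prod μ b c) = prod μ b (prod μ a c) := by
  rw [← hμ.mul_assoc, hμ.mul_comm a b, hμ.mul_assoc]

/-- The Frobenius condition in terms of multiplication operators. -/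
theorem adjoint_mulOp_mul (hμ : IsCommHilbertianFrobeniusSemigroup μ) (a c d : H) :
    (mulOp μ a).adjoint (prod μ c d) = prod μ ((mulOp μ a).adjoint c) d := by
  -- Pairing the left Frobenius identity at `a ⊗ b` with `c ⊗ d` gives the claim; `key`, checked on
  -- `p ⊗ q`, moves `a` across the pairing and is then applied to `μ† b`.
  have key : innerSL ℂ (htmul c d) ∘L hmap μ (ContinuousLinearMap.id ℂ H) ∘L
      (hassoc H H H).symm.toLinearIsometry.toContinuousLinearMap ∘L htmulLeft (HTensor H H) a =
      innerSL ℂ (htmul ((mulOp μ a).adjoint c) d) := by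
    refine ext_htmul fun p q => ?_
    have : (hassoc H H H).symm (htmul a (htmul p q)) = htmul (htmul a p) q := by
      rw [← hassoc_htmul, LinearIsometryEquiv.symm_apply_apply]
    simp [this, inner_htmul, ContinuousLinearMap.adjoint_inner_left, prod]
  refine ext_inner_right ℂ fun b => ?_
  have h1 := DFunLike.congr_fun key (μ.adjoint b)
  have h2 := congrArg (inner ℂ (htmul c d)) (DFunLike.congr_fun hμ.frobenius_left (htmul a b))
  simp only [ContinuousLinearMap.comp_apply, innerSL_apply_apply, htmulLeft_apply,
    hmap_htmul, ContinuousLinearMap.id_apply, ContinuousLinearMap.adjoint_inner_right] at h1 h2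
  rw [ContinuousLinearMap.adjoint_inner_left]
  exact h2.symm.trans h1

theorem isStarNormal_mulOp (hμ : IsCommHilbertianFrobeniusSemigroup μ) (a : H) :
    IsStarNormal (mulOp μ a) := by
  refine ⟨ContinuousLinearMap.ext fun b => ?_⟩
  change (mulOp μ a).adjoint (prod μ a b) = prod μ a ((mulOp μ a).adjoint b)
  rw [hμ.mul_comm, hμ.adjoint_mulOp_mul, hμ.mul_comm]

/-- A dense modular ideal would contain some `a` so near the modular unit `e` that `1 - M_(e-a)` is
invertible; yet that operator maps `H` into the ideal. -/
theorem isMaximalModularLeftIdeal_isClosed (hμ : IsCommHilbertianFrobeniusSemigroup μ)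
    (hI : IsMaximalModularLeftIdeal μ I) : IsClosed (I : Set H) := by
  obtain ⟨⟨hleft, e, he⟩, hne, hmax⟩ := hI
  by_contra hcl
  have htop : I.topologicalClosure = ⊤ := by
    by_contra h
    refine hcl ?_
    rw [← hmax _ hleft.topologicalClosure I.le_topologicalClosure h]
    exact I.isClosed_topologicalClosure
  have hmem : e ∈ closure (I : Set H) := by
    rw [← Submodule.topologicalClosure_coe, htop]
    trivial
  obtain ⟨a, ha, hdist⟩ := Metric.mem_closure_iff.1 hmem (‖μ‖ + 1)⁻¹ (by positivity)
  have hnorm : ‖mulOp μ (e - a)‖ < 1 := by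
    refine (norm_mulOp_le μ _).trans_lt ?_
    rw [dist_eq_norm] at hdist
    have hpos : 0 < ‖μ‖ + 1 := by positivity
    have h1 : (‖μ‖ + 1) * ‖e - a‖ < 1 := by
      simpa [hpos.ne'] using mul_lt_mul_of_pos_left hdist hpos
    linarith [norm_nonneg (e - a), add_mul ‖μ‖ 1 ‖e - a‖]
  have hsurj := (ContinuousLinearMap.isUnit_iff_bijective.1
    (isUnit_one_sub_of_norm_lt_one hnorm)).2
  refine hne (Submodule.eq_top_iff'.2 fun x => ?_)
  obtain ⟨y, rfl⟩ := hsurj x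
  have : (1 - mulOp μ (e - a)) y = (y - prod μ y e) + prod μ y a := by
    rw [mulOp_sub, hμ.mul_comm y e, hμ.mul_comm y a]
    simp
    abel
  rw [this]
  exact add_mem (he y) (hleft y a ha)

/-- The range of `r - M_a` is an ideal with modular unit `r⁻¹ a`. A maximal modular ideal above it
would contain `a`, hence every `r x`. -/
theorem surjective_of_mem_jacobsonRadical (hμ : IsCommHilbertianFrobeniusSemigroup μ)
    (ha : a ∈ jacobsonRadical μ) {r : ℂ} (hr : r ≠ 0) :
    Function.Surjective (algebraMap ℂ (H →L[ℂ] H) r - mulOp μ a) := by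
  set T := algebraMap ℂ (H →L[ℂ] H) r - mulOp μ a with hT
  have hTx (x : H) : T x = r • x - prod μ a x := by
    simp [hT, Algebra.algebraMap_eq_smul_one]
  have hmod : IsModularLeftIdeal μ (LinearMap.range T.toLinearMap) := by
    refine ⟨?_, r⁻¹ • a, fun x => ⟨r⁻¹ • x, ?_⟩⟩
    · rintro x _ ⟨y, rfl⟩
      refine ⟨prod μ x y, ?_⟩
      change T (prod μ x y) = mulOp μ x (T y)
      rw [hTx, hTx, map_sub, map_smul, mulOp_apply, mulOp_apply, hμ.mul_left_comm a x y]
    · change T (r⁻¹ • x) = _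
      rw [map_smul, hTx, hμ.mul_comm x, ← mulOp_apply μ (r⁻¹ • a), mulOp_smul, smul_sub,
        inv_smul_smul₀ hr]
      rfl
  suffices LinearMap.range T.toLinearMap = ⊤ from LinearMap.range_eq_top.1 this
  by_contra hne
  obtain ⟨M, hM, hle⟩ := hmod.exists_le_maximal hne
  have haM : a ∈ M := Submodule.mem_sInf.1 ha M hM
  refine hM.2.1 (Submodule.eq_top_iff'.2 fun x => ?_)
  have h1 : r • x - prod μ a x ∈ M := hTx x ▸ hle ⟨x, rfl⟩
  rw [hμ.mul_comm a x] at h1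
  exact (M.smul_mem_iff hr).1 ((M.sub_mem_iff_left (hM.1.1 x a haM)).1 h1)

theorem mulOp_eq_zero_of_mem_jacobsonRadical (hμ : IsCommHilbertianFrobeniusSemigroup μ)
    (ha : a ∈ jacobsonRadical μ) : mulOp μ a = 0 := by
  have hnormal := hμ.isStarNormal_mulOp a
  have hspec : spectrum ℂ (mulOp μ a) ⊆ {0} := by
    intro r hr
    by_contra hr0
    refine hr ?_
    have hsurj := hμ.surjective_of_mem_jacobsonRadical ha hr0
    have hn : IsStarNormal (algebraMap ℂ (H →L[ℂ] H) r - mulOp μ a) := by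
      refine ⟨?_⟩
      rw [star_sub, ← algebraMap_star_comm]
      have hc (z : ℂ) (S : H →L[ℂ] H) : Commute (algebraMap ℂ (H →L[ℂ] H) z) S :=
        Algebra.commutes z S
      exact (hc _ _).sub_left ((hc _ _).symm.sub_right hnormal.star_comm_self)
    -- For a normal operator the kernel is the orthogonal complement of the range, so surjectivity
    -- forces injectivity.
    refine ContinuousLinearMap.isUnit_iff_bijective.2 ⟨?_, hsurj⟩
    have h := ContinuousLinearMap.IsStarNormal.orthogonal_range hn
    rw [LinearMap.range_eq_top.2 hsurj, Submodule.top_orthogonal_eq_bot] at h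
    exact LinearMap.ker_eq_bot.1 h.symm
  have h := IsStarNormal.spectralRadius_eq_nnnorm (mulOp μ a)
  have h0 : spectralRadius ℂ (mulOp μ a) = 0 := by
    rw [spectralRadius, ← nonpos_iff_eq_zero]
    refine iSup₂_le fun r hr => ?_
    simp [Set.mem_singleton_iff.1 (hspec hr)]
  rw [h0] at h
  simpa using h.symm

theorem mem_jacobsonRadical_iff (hμ : IsCommHilbertianFrobeniusSemigroup μ) :
    a ∈ jacobsonRadical μ ↔ ∀ b, prod μ a b = 0 := by
  constructor
  · intro ha b
    rw [← mulOp_apply, hμ.mulOp_eq_zero_of_mem_jacobsonRadical ha]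
    rfl
  · refine fun ha => Submodule.mem_sInf.2 fun M hM => ?_
    obtain ⟨e, he⟩ := hM.1.2
    simpa [ha e] using he a

/-! ### Maximal modular ideals and group-like elements. -/

/-- A maximal modular ideal has codimension one. -/
theorem exists_sub_smul_mem (hμ : IsCommHilbertianFrobeniusSemigroup μ)
    (hI : IsMaximalModularLeftIdeal μ I) {e : H} (he : ∀ a, a - prod μ a e ∈ I) (a : H) :
    ∃ r : ℂ, a - r • e ∈ I := by
  have hcl := hμ.isMaximalModularLeftIdeal_isClosed hI
  obtain ⟨⟨hleft, -⟩, hne, hmax⟩ := hI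
  have : CompleteSpace I := hcl.completeSpace_coe
  have : Nontrivial Iᗮ := by
    rw [Submodule.nontrivial_iff_ne_bot, Ne, Submodule.orthogonal_eq_bot_iff]
    exact hne
  set P := (Iᗮ).orthogonalProjectionOnto with hP
  have hP0 {x : H} : P x = 0 ↔ x ∈ I := by
    rw [hP, Submodule.orthogonalProjectionOnto_eq_zero_iff, Submodule.orthogonal_orthogonal]
  -- `Iᗮ` models the quotient `H / I`, and `T b` is the operator induced on it by multiplication by
  -- `b`.
  set T : H → Iᗮ →L[ℂ] Iᗮ := fun b => P ∘L mulOp μ b ∘L (Iᗮ).subtypeL with hT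
  have hTP (b x : H) : T b (P x) = P (prod μ b x) := by
    have hx : x - P x ∈ I := by
      rw [← hP0, map_sub, sub_eq_zero, Submodule.orthogonalProjectionOnto_mem_subspace_eq_self]
    have h : P (mulOp μ b (x - P x)) = 0 := hP0.2 (hleft b _ hx)
    rw [map_sub, map_sub, sub_eq_zero] at h
    exact h.symm
  have hPsurj (y : Iᗮ) : ∃ x, P x = y := ⟨y, by simp [hP]⟩
  obtain ⟨r, hr⟩ := spectrum.nonempty (T a)
  refine ⟨r, ?_⟩
  set d := a - r • e with hd
  -- `e` acts as the identity on the quotient, so `T d = T a - r` with `r` in the spectrum of `T a`.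
  have hTd : ¬ IsUnit (T d) := by
    intro hunit
    refine hr ?_
    suffices h : algebraMap ℂ _ r - T a = -T d by
      change IsUnit (algebraMap ℂ _ r - T a)
      rw [h]
      exact hunit.neg
    ext1 y
    obtain ⟨x, rfl⟩ := hPsurj y
    have hex : P (prod μ e x) = P x := by
      rw [eq_comm, ← sub_eq_zero, ← map_sub, hP0, hμ.mul_comm]
      exact he x
    rw [neg_apply, hTP, hd, ← mulOp_apply, mulOp_sub, mulOp_smul]
    simp [hTP, hex, Algebra.algebraMap_eq_smul_one]
  -- If `d ∉ I`, maximality of `I` makes `T d` bijective: both `{x | d x ∈ I}` and `I + d H` are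
  -- ideals containing `I`.
  by_contra hdI
  have hker : ∀ x, prod μ d x ∈ I → x ∈ I := by
    have h := hmax (I.comap (mulOp μ d).toLinearMap)
      (fun x y hy => by
        change prod μ d (prod μ x y) ∈ I
        rw [hμ.mul_left_comm]
        exact hleft x _ hy)
      (fun x hx => hleft d x hx)
      (fun htop => hdI ?_)
    · exact fun x hx => h.le hx
    · have hde : prod μ d e ∈ I := (htop ▸ trivial : e ∈ I.comap (mulOp μ d).toLinearMap)
      exact (I.sub_mem_iff_left hde).1 (he d)
  have hrange : I ⊔ LinearMap.range (mulOp μ d).toLinearMap = ⊤ := by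
    by_contra htop
    have h := hmax _ (fun x y hy => ?_) le_sup_left htop
    · refine hdI ((I.sub_mem_iff_left ?_).1 (he d))
      exact h.le (Submodule.mem_sup_right ⟨e, rfl⟩)
    · obtain ⟨i, hi, _, ⟨z, rfl⟩, rfl⟩ := Submodule.mem_sup.1 hy
      rw [← mulOp_apply, map_add]
      refine add_mem (Submodule.mem_sup_left (hleft x i hi)) (Submodule.mem_sup_right ⟨prod μ x z, ?_⟩)
      exact hμ.mul_left_comm d x z
  refine hTd (ContinuousLinearMap.isUnit_iff_bijective.2 ⟨?_, fun y => ?_⟩)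
  · refine (injective_iff_map_eq_zero _).2 fun y hy => ?_
    obtain ⟨x, rfl⟩ := hPsurj y
    rw [hTP, hP0] at hy
    exact hP0.2 (hker x hy)
  · obtain ⟨x, rfl⟩ := hPsurj y
    obtain ⟨i, hi, _, ⟨z, rfl⟩, rfl⟩ :=
      Submodule.mem_sup.1 (hrange ▸ trivial : x ∈ I ⊔ LinearMap.range (mulOp μ d).toLinearMap)
    refine ⟨P z, ?_⟩
    rw [hTP, map_add, hP0.2 hi, zero_add]
    rfl

theorem mem_groupLike_iff : g ∈ groupLike μ ↔
    g ≠ 0 ∧ ∀ a b, ⟪g, prod μ a b⟫_ℂ = ⟪g, a⟫_ℂ * ⟪g, b⟫_ℂ := by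
  refine and_congr_right fun _ => ⟨fun h a b => ?_, fun h => eq_of_inner_htmul fun a b => ?_⟩
  · rw [prod, ← ContinuousLinearMap.adjoint_inner_left, h, inner_htmul]
  · rw [ContinuousLinearMap.adjoint_inner_left, inner_htmul]
    exact h a b

/-- Every maximal modular ideal is the orthogonal complement of a group-like element. -/
theorem exists_groupLike (hμ : IsCommHilbertianFrobeniusSemigroup μ)
    (hI : IsMaximalModularLeftIdeal μ I) :
    ∃ g ∈ groupLike μ, ∀ a, a ∈ I ↔ ⟪g, a⟫_ℂ = 0 := by
  obtain ⟨e, he⟩ := hI.1.2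
  have hleft := hI.1.1
  have hcl := hμ.isMaximalModularLeftIdeal_isClosed hI
  have : CompleteSpace I := hcl.completeSpace_coe
  have heI : e ∉ I := fun h => hI.2.1 (hleft.eq_top_of_modular_unit_mem he h)
  obtain ⟨i, hi, k, hk, hik⟩ := I.exists_add_mem_mem_orthogonal e
  have hk0 : k ≠ 0 := by
    rintro rfl
    exact heI (by simpa [hik] using hi)
  have hke : ⟪k, e⟫_ℂ = ⟪k, k⟫_ℂ := by
    rw [hik, inner_add_right, Submodule.inner_left_of_mem_orthogonal hi hk, zero_add]
  have hkk : ⟪k, k⟫_ℂ ≠ 0 := inner_self_ne_zero.2 hk0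
  -- The scalar normalizes `⟪g, e⟫ = 1`; the conjugate appears because the inner product is
  -- conjugate-linear on the left.
  set g : H := (starRingEnd ℂ ⟪k, k⟫_ℂ)⁻¹ • k with hg
  have hge : ⟪g, e⟫_ℂ = 1 := by
    rw [hg, inner_smul_left, hke, map_inv₀, Complex.conj_conj, inv_mul_cancel₀ hkk]
  have hgI {x : H} (hx : x ∈ I) : ⟪g, x⟫_ℂ = 0 := by
    rw [hg, inner_smul_left, Submodule.inner_left_of_mem_orthogonal hx hk, mul_zero]
  have hsub (a : H) : a - ⟪g, a⟫_ℂ • e ∈ I := by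
    obtain ⟨r, hr⟩ := hμ.exists_sub_smul_mem hI he a
    have h := hgI hr
    rw [inner_sub_right, inner_smul_right, hge, mul_one, sub_eq_zero] at h
    rwa [h]
  refine ⟨g, mem_groupLike_iff.2 ⟨fun h => by simp [h] at hge, fun a b => ?_⟩,
    fun a => ⟨hgI, fun h => by simpa [h] using hsub a⟩⟩
  -- Modulo `I`, `a b` is `⟪g, b⟫ a e` and `a e` is `a`.
  have h1 := hgI (hleft a _ (hsub b))
  have h2 := hgI (he a)
  rw [← mulOp_apply, map_sub, map_smul, inner_sub_right, inner_smul_right, mulOp_apply,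
    mulOp_apply, sub_eq_zero] at h1
  rw [inner_sub_right, sub_eq_zero] at h2
  rw [h1, ← h2, _root_.mul_comm]

/-! ### The orthogonal decomposition and its two summands. -/

theorem isClosed_jacobsonRadical (hμ : IsCommHilbertianFrobeniusSemigroup μ) :
    IsClosed (jacobsonRadical μ : Set H) := by
  rw [jacobsonRadical, Submodule.coe_sInf]
  exact isClosed_biInter fun I hI => hμ.isMaximalModularLeftIdeal_isClosed hI

theorem mem_jacobsonRadical_of_inner_groupLike (hμ : IsCommHilbertianFrobeniusSemigroup μ)
    (ha : ∀ g ∈ groupLike μ, ⟪g, a⟫_ℂ = 0) : a ∈ jacobsonRadical μ := by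
  refine Submodule.mem_sInf.2 fun I hI => ?_
  obtain ⟨g, hg, h⟩ := hμ.exists_groupLike hI
  exact (h a).2 (ha g hg)

/-- Since `a g = 0`, multiplicativity gives `⟪g, a⟫ ⟪g, g⟫ = 0`. -/
theorem inner_groupLike_eq_zero (hμ : IsCommHilbertianFrobeniusSemigroup μ)
    (hg : g ∈ groupLike μ) (ha : a ∈ jacobsonRadical μ) : ⟪g, a⟫_ℂ = 0 := by
  have h := (mem_groupLike_iff.1 hg).2 a g
  rw [hμ.mem_jacobsonRadical_iff.1 ha, inner_zero_right, eq_comm, mul_eq_zero] at h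
  exact h.resolve_right (inner_self_ne_zero.2 hg.1)

theorem jacobsonRadical_eq_orthogonal_span (hμ : IsCommHilbertianFrobeniusSemigroup μ) :
    jacobsonRadical μ = (Submodule.span ℂ (groupLike μ))ᗮ := by
  ext a
  rw [Submodule.mem_orthogonal]
  refine ⟨fun ha u hu => ?_, fun h => hμ.mem_jacobsonRadical_of_inner_groupLike fun g hg =>
    h g (Submodule.subset_span hg)⟩
  induction hu using Submodule.span_induction with
  | mem g hg => exact hμ.inner_groupLike_eq_zero hg ha
  | zero => simp
  | add x y _ _ hx hy => rw [inner_add_left, hx, hy, add_zero]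
  | smul r x _ hx => rw [inner_smul_left, hx, mul_zero]

theorem orthogonal_jacobsonRadical (hμ : IsCommHilbertianFrobeniusSemigroup μ) :
    (jacobsonRadical μ)ᗮ = (Submodule.span ℂ (groupLike μ)).topologicalClosure := by
  rw [hμ.jacobsonRadical_eq_orthogonal_span, Submodule.orthogonal_orthogonal_eq_closure]

/-- Every element of the radical is orthogonal to all products. -/
theorem inner_mul_eq_zero (hμ : IsCommHilbertianFrobeniusSemigroup μ)
    (ha : a ∈ jacobsonRadical μ) (b c : H) : ⟪a, prod μ b c⟫_ℂ = 0 := by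
  have hker : a ∈ (mulOp μ b).ker := by
    change prod μ b a = 0
    rw [hμ.mul_comm, hμ.mem_jacobsonRadical_iff.1 ha]
  rw [← ContinuousLinearMap.IsStarNormal.ker_adjoint_eq_ker (hμ.isStarNormal_mulOp b)] at hker
  have h : (mulOp μ b).adjoint a = 0 := hker
  rw [← mulOp_apply, ← ContinuousLinearMap.adjoint_inner_left, h, inner_zero_left]

theorem adjoint_eq_zero_of_mem_jacobsonRadical (hμ : IsCommHilbertianFrobeniusSemigroup μ)
    (ha : a ∈ jacobsonRadical μ) : μ.adjoint a = 0 :=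
  eq_of_inner_htmul fun b c => by
    rw [ContinuousLinearMap.adjoint_inner_left, inner_zero_left]
    exact hμ.inner_mul_eq_zero ha b c

theorem apply_mem_orthogonal_jacobsonRadical (hμ : IsCommHilbertianFrobeniusSemigroup μ)
    (t : HTensor H H) : μ t ∈ (jacobsonRadical μ)ᗮ := fun a ha => by
  rw [← ContinuousLinearMap.adjoint_inner_left, hμ.adjoint_eq_zero_of_mem_jacobsonRadical ha,
    inner_zero_left]

theorem isClosedSubalgebra_jacobsonRadical (hμ : IsCommHilbertianFrobeniusSemigroup μ) :
    IsClosedSubalgebra μ (jacobsonRadical μ) where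
  isClosed := hμ.isClosed_jacobsonRadical
  mul_mem := by
    rintro _ ⟨s, rfl⟩
    have h : μ ∘L hmap (jacobsonRadical μ).subtypeL (jacobsonRadical μ).subtypeL = 0 :=
      ext_htmul fun a b => by
        simpa [prod] using hμ.mem_jacobsonRadical_iff.1 a.2 b
    have hs := DFunLike.congr_fun h s
    change μ (hmap _ _ s) ∈ _
    rw [← ContinuousLinearMap.comp_apply, hs]
    exact zero_mem _

theorem isClosedSubcoalgebra_orthogonal_jacobsonRadical
    (hμ : IsCommHilbertianFrobeniusSemigroup μ) :
    IsClosedSubcoalgebra μ (jacobsonRadical μ)ᗮ where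
  isClosed := Submodule.isClosed_orthogonal _
  comul_mem := by
    -- The right side is a closed subspace, so it suffices to test group-like elements, which span a
    -- dense subspace of `Jᗮ`.
    suffices (jacobsonRadical μ)ᗮ ≤
        (tensorSquare (jacobsonRadical μ)ᗮ).comap μ.adjoint.toLinearMap from
      fun a ha => this ha
    conv_lhs => rw [hμ.orthogonal_jacobsonRadical]
    refine Submodule.topologicalClosure_minimal _ (Submodule.span_le.2 fun g hg => ?_)
      ((isClosed_tensorSquare _).preimage μ.adjoint.continuous)
    have hmem : g ∈ (jacobsonRadical μ)ᗮ := by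
      rw [hμ.orthogonal_jacobsonRadical]
      exact Submodule.le_topologicalClosure _ (Submodule.subset_span hg)
    change μ.adjoint g ∈ tensorSquare _
    rw [hg.2]
    exact htmul_mem_tensorSquare hmem hmem

end IsCommHilbertianFrobeniusSemigroup

end HilbFrob

end

theorem mainTheorem1 {H : Type*} [NormedAddCommGroup H] [InnerProductSpace ℂ H] [CompleteSpace H]
    (μ : HilbFrob.HTensor H H →L[ℂ] H)
    (hμ : HilbFrob.IsCommHilbertianFrobeniusSemigroup μ) :
    IsClosed (HilbFrob.jacobsonRadical μ : Set H) ∧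
    IsCompl (HilbFrob.jacobsonRadical μ) (HilbFrob.jacobsonRadical μ)ᗮ ∧
    (HilbFrob.jacobsonRadical μ)ᗮ =
      (Submodule.span ℂ (HilbFrob.groupLike μ)).topologicalClosure ∧
    HilbFrob.IsClosedSubalgebra μ (HilbFrob.jacobsonRadical μ)ᗮ ∧
    HilbFrob.IsClosedSubcoalgebra μ (HilbFrob.jacobsonRadical μ)ᗮ ∧
    HilbFrob.IsClosedSubalgebra μ (HilbFrob.jacobsonRadical μ) ∧
    HilbFrob.IsClosedSubcoalgebra μ (HilbFrob.jacobsonRadical μ) ∧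
    HilbFrob.IsIdeal μ (HilbFrob.jacobsonRadical μ) ∧
    HilbFrob.IsIdeal μ (HilbFrob.jacobsonRadical μ)ᗮ ∧
    (HilbFrob.jacobsonRadical μ : Set H) = HilbFrob.annihilator μ := by
  have : CompleteSpace (HilbFrob.jacobsonRadical μ) := hμ.isClosed_jacobsonRadical.completeSpace_coe
  refine ⟨hμ.isClosed_jacobsonRadical, Submodule.isCompl_orthogonal _,
    hμ.orthogonal_jacobsonRadical,
    ⟨Submodule.isClosed_orthogonal _, fun t _ => hμ.apply_mem_orthogonal_jacobsonRadical t⟩,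
    hμ.isClosedSubcoalgebra_orthogonal_jacobsonRadical,
    hμ.isClosedSubalgebra_jacobsonRadical,
    ⟨hμ.isClosed_jacobsonRadical, fun a ha => ?_⟩,
    fun a b hb => ?_,
    fun a b _ => ⟨hμ.apply_mem_orthogonal_jacobsonRadical _,
      hμ.apply_mem_orthogonal_jacobsonRadical _⟩,
    Set.ext fun a => hμ.mem_jacobsonRadical_iff⟩
  · rw [hμ.adjoint_eq_zero_of_mem_jacobsonRadical ha]
    exact zero_mem _
  · rw [hμ.mul_comm a b, hμ.mem_jacobsonRadical_iff.1 hb]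
    exact ⟨zero_mem _, zero_mem _⟩
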